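/- Consider bandits with $n$ independent arms, each with a finite set $\mathcal S$ of states. An arm that is not played keeps its state and yields nothing. If arm $i$ is in state $k$ and is played $t\ge 1$ steps after its previous play, it yields the reward $r^i_k\ge 0$ and moves to state $j\ne k$ with probability $q^i_{kj}(t)\ge 0$, staying in $k$ with the remaining probability, where $\sum_{j\ne k}q^i_{kj}(t)\le 1$ and every $q^i_{kj}(t)$ is non-decreasing in $t$. At most one arm is played per step, and the goal is to maximize the infinite-horizon time-average expected reward; the policy may be randomized and history-dependent, and it may choose the initial states. The transition probabilities are called separable if $q^i_{kj}(t)=f^i_k(t)\,q^i(k,j)$ for all $i$, $k\neq j$, $t$, with $f^i_k(t)\in[0,1]$, $q^i(k,j)\ge 0$, $\sum_{j\ne k}q^i(k,j)\le 1$. Whittle's LP for such a bandit is $$\max \sum_{i=1}^n\sum_{k}\sum_{t\ge1} r^i_k x^i_{kt}\quad\text{subject to}\quad \sum_{i=1}^n\sum_k\sum_{t\ge 1} x^i_{kt}\le 1,\qquad \sum_k\sum_{t\ge1} t\,x^i_{kt}\le 1\ \ \forall i,$$ $$\sum_{j\ne k}\sum_{t\ge1} x^i_{kt}\,q^i_{kj}(t)=\sum_{j\neq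 k}\sum_{t\ge 1}x^i_{jt}\,q^i_{jk}(t)\ \ \forall i,k,\qquad x^i_{kt}\ge 0\ \ \forall i,k,t.$$ Theorem. If separability is not required, Whittle's LP has an $\Omega(n)$ gap even with $K=3$ states per arm. Precisely, there are constants $c,C>0$ such that for every $n\ge1$ there is a bandit as above with $n$ arms and $3$ states per arm, whose transition probabilities are non-decreasing in $t$ but not separable, in which every arm has an absorbing state of reward $0$, and such that 1. the optimal value $\mathrm{LP}$ of Whittle's LP satisfies $c\le \mathrm{LP}\le C$; 2. every policy, from every initial state, has time-average expected reward (limit superior) at most $1/n$; 3. hence, with $\mathrm{OPT}$ the supremum of the time-average expected rewards over all policies and initial states, $\mathrm{LP}\ge c\,n\cdot \mathrm{OPT}$. -/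

import Mathlib

/-- A bandit with `n` arms and `K` states per arm whose transition probabilities are monotone in the
time since the last play. `q i k j t` (for `j ≠ k`) is the probability that arm `i`, in state `k` and
played `t ≥ 1` steps after its previous play, moves to state `j`; with the remaining probability it
stays in `k`. The values `q i k k t` carry no information. -/
structure MonotoneTransitionBandit (n K : ℕ) where
  reward : Fin n → Fin K → ℝ
  q : Fin n → Fin K → Fin K → ℕ+ → ℝ
  reward_nonneg : ∀ i k, 0 ≤ reward i k
  q_nonneg : ∀ i k j t, j ≠ k → 0 ≤ q i k j t
  q_sum_le_one : ∀ i k t, ∑ j ∈ Finset.univ.erase k, q i k j t ≤ 1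
  q_monotone : ∀ i k j, j ≠ k → Monotone (q i k j)

namespace MonotoneTransitionBandit

variable {n K : ℕ}

/-- Separability: the transition probabilities are of the form `f_k(t) q(k, j)`, with an escape
probability `f_k(t) ∈ [0, 1]` and a sub-probability vector `q(k, ·)` on the states other than `k`. -/
def Separable (B : MonotoneTransitionBandit n K) : Prop :=
  ∃ (f : Fin n → Fin K → ℕ+ → ℝ) (w : Fin n → Fin K → Fin K → ℝ),
    (∀ i k t, 0 ≤ f i k t ∧ f i k t ≤ 1) ∧
    (∀ i k j, j ≠ k → 0 ≤ w i k j) ∧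
    (∀ i k, ∑ j ∈ Finset.univ.erase k, w i k j ≤ 1) ∧
    ∀ i k j t, j ≠ k → B.q i k j t = f i k t * w i k j

/-- State `a` of arm `i` is never left. -/
def IsAbsorbing (B : MonotoneTransitionBandit n K) (i : Fin n) (a : Fin K) : Prop :=
  ∀ j t, j ≠ a → B.q i a j t = 0

/-! ### Whittle's linear program -/

/-- Feasibility for Whittle's LP. The variable `x i k t` stands for the rate at which arm `i` is
played in state `k`, `t` steps after its previous play. -/
structure WhittleFeasible (B : MonotoneTransitionBandit n K) (x : Fin n → Fin K → ℕ+ → ℝ) : Prop where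
  nonneg : ∀ i k t, 0 ≤ x i k t
  summable : ∀ i k, Summable fun t : ℕ+ => (t : ℝ) * x i k t
  one_play : ∑ i, ∑ k, ∑' t : ℕ+, x i k t ≤ 1
  one_state : ∀ i, ∑ k, ∑' t : ℕ+, (t : ℝ) * x i k t ≤ 1
  balance : ∀ i k,
    ∑ j ∈ Finset.univ.erase k, ∑' t : ℕ+, x i k t * B.q i k j t =
      ∑ j ∈ Finset.univ.erase k, ∑' t : ℕ+, x i j t * B.q i j k t

/-- The objective of Whittle's LP. -/
noncomputable def whittleObjective (B : MonotoneTransitionBandit n K)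
    (x : Fin n → Fin K → ℕ+ → ℝ) : ℝ :=
  ∑ i, ∑ k, ∑' t : ℕ+, B.reward i k * x i k t

/-- The optimal value of Whittle's LP. -/
noncomputable def whittleValue (B : MonotoneTransitionBandit n K) : EReal :=
  ⨆ (x : Fin n → Fin K → ℕ+ → ℝ) (_ : B.WhittleFeasible x), (B.whittleObjective x : EReal)

/-! ### Policies and their time-average reward -/

/-- A joint state: for every arm its state and the number of steps since its last play. -/
abbrev JointState (n K : ℕ) := Fin n → Fin K × ℕ+

/-- A randomized history-dependent policy: from the past (joint states and actions, most recent
first) and the current joint state, it gives the law of the next action, which is to play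
arm `i` (`some i`) or no arm (`none`). -/
abbrev Policy (n K : ℕ) :=
  List (JointState n K × Option (Fin n)) → JointState n K → PMF (Option (Fin n))

/-- The probability that arm `i`, played in state `k` after `t` steps, is next in state `j`. -/
noncomputable def stepProb (B : MonotoneTransitionBandit n K) (i : Fin n) (k : Fin K) (t : ℕ+)
    (j : Fin K) : ℝ :=
  if j = k then 1 - ∑ l ∈ Finset.univ.erase k, B.q i k l t else B.q i k j t

/-- The next joint state if no arm is played. -/
def afterIdle (s : JointState n K) : JointState n K := fun i => ((s i).1, (s i).2 + 1)

/-- The next joint state if arm `i` is played and is then in state `j`. -/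
def afterPlay (s : JointState n K) (i : Fin n) (j : Fin K) : JointState n K :=
  Function.update (afterIdle s) i (j, 1)

/-- The expected total reward of the policy `π` in the next `T` steps, given the past `h` and the
current joint state `s`. -/
noncomputable def expReward (B : MonotoneTransitionBandit n K) (π : Policy n K) :
    ℕ → List (JointState n K × Option (Fin n)) → JointState n K → ℝ
  | 0, _, _ => 0
  | T + 1, h, s =>
      (π h s none).toReal * expReward B π T ((s, none) :: h) (afterIdle s) +
      ∑ i, (π h s (some i)).toReal *
        (B.reward i (s i).1 +
          ∑ j, B.stepProb i (s i).1 (s i).2 j *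
            expReward B π T ((s, some i) :: h) (afterPlay s i j))

/-- The infinite-horizon time-average expected reward (limit superior) of `π` started in `s`. -/
noncomputable def averageReward (B : MonotoneTransitionBandit n K) (π : Policy n K)
    (s : JointState n K) : EReal :=
  Filter.limsup (fun T : ℕ => ((B.expReward π T [] s / (T : ℝ) : ℝ) : EReal)) Filter.atTop

/-- The optimal time-average reward, over all policies and all initial joint states. -/
noncomputable def optimalReward (B : MonotoneTransitionBandit n K) : EReal :=
  ⨆ (π : Policy n K) (s : JointState n K), B.averageReward π s

end MonotoneTransitionBandit

/-! Write L = `stayLength n` = 2n². A run in state 0, played every step, lasts L steps on average. A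
waiting arm restarts a run with probability 1/L when played at its deadline n; neglecting an arm in
either state makes its next play fatal with probability 1 - 1/L. The LP couples arms only through
average rates, so all n arms may alternate between plays at (0, 1) and (1, n), for total reward 1/2
(`gapPoint_feasible`).

A real policy cannot do this: a run blocks every other play. If another live arm waits, its deadline
forces an end within n steps, so a restart attempt is worth at most about n/L = 1/(2n). A sole live
arm can run undisturbed and earn L on average, but attempts then come only every n steps and succeed
with probability 1/L, which again gives 1/n per step. Losing an arm to get there has negligible
probability of being undone.

The proof is a drift argument (`expReward_le_of_potential`): `armValue` pays for losses, and
`coupling` stores the expected remaining reward of the current run or, for a sole waiting arm, the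
savings for its next attempt. The core is `coupling_afterPlay_zero_of_running`,
`coupling_afterPlay_zero_of_deadline` and `gapBandit_drift_le_of_coupling`. -/

namespace MonotoneTransitionBandit

/-! ### Drift criterion for arbitrary bandits -/

section Potential

variable {n K : ℕ}

lemma stepProb_nonneg (B : MonotoneTransitionBandit n K) (i : Fin n) (k : Fin K) (t : ℕ+)
    (j : Fin K) : 0 ≤ B.stepProb i k t j := by
  unfold stepProb
  split_ifs with h
  · linarith [B.q_sum_le_one i k t]
  · exact B.q_nonneg i k j t h

lemma sum_stepProb (B : MonotoneTransitionBandit n K) (i : Fin n) (k : Fin K) (t : ℕ+) :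
    ∑ j, B.stepProb i k t j = 1 := by
  rw [← Finset.add_sum_erase _ _ (Finset.mem_univ k)]
  have : ∑ j ∈ Finset.univ.erase k, B.stepProb i k t j
      = ∑ j ∈ Finset.univ.erase k, B.q i k j t :=
    Finset.sum_congr rfl fun j hj => by simp [stepProb, Finset.ne_of_mem_erase hj]
  rw [this]
  simp [stepProb]

lemma sum_toReal_option (μ : PMF (Option (Fin n))) :
    (μ none).toReal + ∑ i, (μ (some i)).toReal = 1 := by
  have h := μ.tsum_coe
  rw [tsum_fintype, Fintype.sum_option] at h
  have h' := congrArg ENNReal.toReal h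
  rwa [ENNReal.toReal_add (μ.apply_ne_top _) (ENNReal.sum_ne_top.2 fun i _ => μ.apply_ne_top _),
    ENNReal.toReal_sum fun i _ => μ.apply_ne_top _, ENNReal.toReal_one] at h'

/-- A nonnegative potential whose drift under every action compensates the reward up to `g` per
step bounds the expected reward of every policy. -/
theorem expReward_le_of_potential (B : MonotoneTransitionBandit n K) (Φ : JointState n K → ℝ)
    (g : ℝ) (hΦ : ∀ s, 0 ≤ Φ s) (hidle : ∀ s, Φ (afterIdle s) ≤ Φ s + g)
    (hplay : ∀ s i, B.reward i (s i).1 +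
      ∑ j, B.stepProb i (s i).1 (s i).2 j * Φ (afterPlay s i j) ≤ Φ s + g)
    (π : Policy n K) (T : ℕ) (h : List (JointState n K × Option (Fin n))) (s : JointState n K) :
    B.expReward π T h s ≤ Φ s + T * g := by
  induction T generalizing h s with
  | zero => simpa [expReward] using hΦ s
  | succ T ih =>
    have hi : B.expReward π T ((s, none) :: h) (afterIdle s) ≤ Φ s + (T + 1) * g := by
      linarith [ih ((s, none) :: h) (afterIdle s), hidle s]
    have hp : ∀ i, B.reward i (s i).1 + ∑ j, B.stepProb i (s i).1 (s i).2 j *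
        B.expReward π T ((s, some i) :: h) (afterPlay s i j) ≤ Φ s + (T + 1) * g := by
      intro i
      have h1 : ∑ j, B.stepProb i (s i).1 (s i).2 j *
          B.expReward π T ((s, some i) :: h) (afterPlay s i j) ≤
          ∑ j, B.stepProb i (s i).1 (s i).2 j * (Φ (afterPlay s i j) + T * g) :=
        Finset.sum_le_sum fun j _ =>
          mul_le_mul_of_nonneg_left (ih _ _) (B.stepProb_nonneg _ _ _ _)
      simp only [mul_add, Finset.sum_add_distrib] at h1
      rw [← Finset.sum_mul, sum_stepProb] at h1
      linarith [hplay s i]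
    have h2 : ∑ i, (π h s (some i)).toReal * (B.reward i (s i).1 +
        ∑ j, B.stepProb i (s i).1 (s i).2 j *
          B.expReward π T ((s, some i) :: h) (afterPlay s i j)) ≤
        ∑ i, (π h s (some i)).toReal * (Φ s + (T + 1) * g) :=
      Finset.sum_le_sum fun i _ => mul_le_mul_of_nonneg_left (hp i) ENNReal.toReal_nonneg
    rw [← Finset.sum_mul] at h2
    have h3 := mul_le_mul_of_nonneg_left hi (ENNReal.toReal_nonneg (a := π h s none))
    have h4 := sum_toReal_option (π h s)
    rw [expReward]
    push_cast
    calc _ ≤ ((π h s none).toReal + ∑ i, (π h s (some i)).toReal) * (Φ s + (T + 1) * g) := by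
          linarith
      _ = _ := by rw [h4, one_mul]

theorem averageReward_le_of_expReward_le (B : MonotoneTransitionBandit n K) (π : Policy n K)
    (s : JointState n K) (a g : ℝ) (h : ∀ T : ℕ, B.expReward π T [] s ≤ a + T * g) :
    B.averageReward π s ≤ (g : EReal) := by
  have hlim : Filter.Tendsto (fun T : ℕ => ((a / (T : ℝ) + g : ℝ) : EReal)) Filter.atTop
      (nhds (g : EReal)) := by
    refine (continuous_coe_real_ereal.tendsto g).comp ?_
    simpa using (tendsto_const_div_atTop_nhds_zero_nat a).add_const g
  rw [averageReward, ← hlim.limsup_eq]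
  refine Filter.limsup_le_limsup ?_
  filter_upwards [Filter.eventually_gt_atTop 0] with T hT
  have hT' : (0 : ℝ) < T := by exact_mod_cast hT
  rw [EReal.coe_le_coe_iff, div_le_iff₀ hT']
  have : (a / T + g) * T = a + T * g := by field_simp
  rw [this]
  exact h T

end Potential

/-! ### Upper bound on Whittle's LP -/

section WhittleBounds

variable {n K : ℕ}

/-- Termwise comparison of `tsum`s needs this, as a divergent `tsum` defaults to 0. -/
lemma WhittleFeasible.summable_self {B : MonotoneTransitionBandit n K}
    {x : Fin n → Fin K → ℕ+ → ℝ} (hx : B.WhittleFeasible x) (i : Fin n) (k : Fin K) :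
    Summable (x i k) := by
  refine Summable.of_nonneg_of_le (hx.nonneg i k) (fun t => ?_) (hx.summable i k)
  have : (1 : ℝ) ≤ t := Nat.one_le_cast.2 t.pos
  nlinarith [hx.nonneg i k t]

lemma whittleValue_le_one_of_reward_le_one (B : MonotoneTransitionBandit n K)
    (hr : ∀ i k, B.reward i k ≤ 1) : B.whittleValue ≤ ((1 : ℝ) : EReal) := by
  refine iSup₂_le fun x hx => ?_
  rw [EReal.coe_le_coe_iff]
  refine le_trans ?_ hx.one_play
  refine Finset.sum_le_sum fun i _ => Finset.sum_le_sum fun k _ => ?_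
  refine Summable.tsum_le_tsum (fun t => ?_) ((hx.summable_self i k).mul_left _)
    (hx.summable_self i k)
  nlinarith [hx.nonneg i k t, hr i k]

end WhittleBounds

/-! ### The gap instance

State `0` is the rewarding one and has to be played in every step, state `1` is the waiting state
and has to be played every `n` steps, state `2` is absorbing. -/

section GapInstance

variable {n : ℕ}

/-- The expected length of a stay in the rewarding state. -/
noncomputable def stayLength (n : ℕ) : ℝ := 2 * (n : ℝ) ^ 2

/-- The transition probabilities of the gap instance. -/
noncomputable def gapQ (n : ℕ) (k j : Fin 3) (t : ℕ+) : ℝ :=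
  if k = 0 then
    if j = 1 then (stayLength n)⁻¹ else if t = 1 then 0 else 1 - (stayLength n)⁻¹
  else if k = 1 then
    if j = 0 then (if n ≤ (t : ℕ) then (stayLength n)⁻¹ else 0)
    else if (t : ℕ) ≤ n then 0 else 1 - (stayLength n)⁻¹
  else 0

lemma two_mul_le_stayLength (hn : 1 ≤ n) : 2 * (n : ℝ) ≤ stayLength n := by
  have : (1 : ℝ) ≤ n := by exact_mod_cast hn
  unfold stayLength
  nlinarith

lemma two_le_stayLength (hn : 1 ≤ n) : 2 ≤ stayLength n := by
  have : (1 : ℝ) ≤ n := by exact_mod_cast hn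
  linarith [two_mul_le_stayLength hn]

lemma inv_stayLength_pos (hn : 1 ≤ n) : 0 < (stayLength n)⁻¹ :=
  inv_pos.2 (by linarith [two_le_stayLength hn])

lemma inv_stayLength_le (hn : 1 ≤ n) : (stayLength n)⁻¹ ≤ 1 / 2 := by
  rw [one_div]
  exact inv_anti₀ (by norm_num) (two_le_stayLength hn)

lemma inv_stayLength_mul (hn : 1 ≤ n) : (stayLength n)⁻¹ * stayLength n = 1 :=
  inv_mul_cancel₀ (by linarith [two_le_stayLength hn])

lemma univ_erase_zero : (Finset.univ : Finset (Fin 3)).erase 0 = {1, 2} := by decide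
lemma univ_erase_one : (Finset.univ : Finset (Fin 3)).erase 1 = {0, 2} := by decide
lemma univ_erase_two : (Finset.univ : Finset (Fin 3)).erase 2 = {0, 1} := by decide

/-- The instance with a large gap between Whittle's LP and the optimal policy. -/
noncomputable def gapBandit (n : ℕ) (hn : 1 ≤ n) : MonotoneTransitionBandit n 3 where
  reward _ k := if k = 0 then 1 else 0
  q _ := gapQ n
  reward_nonneg _ k := by split_ifs <;> norm_num
  q_nonneg _ k j t _ := by
    have h1 := inv_stayLength_pos hn
    have h2 := inv_stayLength_le hn
    unfold gapQ
    split_ifs <;> linarith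
  q_sum_le_one _ k t := by
    have h1 := inv_stayLength_pos hn
    have h2 := inv_stayLength_le hn
    fin_cases k
    · simp [univ_erase_zero, gapQ]
      split_ifs <;> linarith
    · simp [univ_erase_one, gapQ]
      split_ifs <;> linarith
    · simp [gapQ]
  q_monotone _ k j _ t u htu := by
    have h1 := inv_stayLength_pos hn
    have h2 := inv_stayLength_le hn
    have htu' : (t : ℕ) ≤ u := htu
    have htu1 : u = 1 → t = 1 := fun h => le_antisymm (h ▸ htu) one_le
    unfold gapQ
    split_ifs <;> first | linarith | (exfalso; tauto)

lemma gapBandit_isAbsorbing (hn : 1 ≤ n) (i : Fin n) : (gapBandit n hn).IsAbsorbing i 2 := by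
  intro j t _
  simp [gapBandit, gapQ]

/-- From state 1, the move to 0 is possible at time n while the move to 2 is not, so a common factor
f forces w(1, 2) = 0; but the move to 2 is possible at time n + 1. -/
lemma gapBandit_not_separable (hn : 1 ≤ n) : ¬ (gapBandit n hn).Separable := by
  rintro ⟨f, w, -, -, -, h⟩
  have hp := inv_stayLength_pos hn
  have hp' := inv_stayLength_le hn
  have h1 := h ⟨0, hn⟩ 1 0 ⟨n, hn⟩ (by decide)
  have h2 := h ⟨0, hn⟩ 1 2 ⟨n, hn⟩ (by decide)
  have h3 := h ⟨0, hn⟩ 1 2 ⟨n + 1, by omega⟩ (by decide)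
  simp [gapBandit, gapQ] at h1 h2 h3
  rcases h2 with h2 | h2
  · rw [h2, zero_mul] at h1
    linarith
  · rw [h2, mul_zero] at h3
    linarith

/-! ### Lower bound on Whittle's LP -/

/-- The longest waiting time after which a waiting arm can be played without a loss. -/
def deadline (n : ℕ) (hn : 1 ≤ n) : ℕ+ := ⟨n, hn⟩

@[simp]
lemma coe_deadline (hn : 1 ≤ n) : (deadline n hn : ℕ) = n := rfl

/-- A feasible point of Whittle's LP for the gap instance: every arm is played at rate `1 / (2 n)`
in state `0` after one step, and at the same rate in state `1` after `n` steps. -/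
noncomputable def gapPoint (n : ℕ) (hn : 1 ≤ n) (_ : Fin n) (k : Fin 3) : ℕ+ → ℝ :=
  if k = 0 then Pi.single 1 (1 / (2 * (n : ℝ)))
  else if k = 1 then Pi.single (deadline n hn) (1 / (2 * (n : ℝ))) else 0

lemma tsum_mul_single (f : ℕ+ → ℝ) (u : ℕ+) (a : ℝ) :
    ∑' t, f t * (Pi.single u a : ℕ+ → ℝ) t = f u * a := by
  rw [tsum_eq_single u]
  · simp
  · intro t ht
    simp [ht]

lemma tsum_single_mul (f : ℕ+ → ℝ) (u : ℕ+) (a : ℝ) :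
    ∑' t, (Pi.single u a : ℕ+ → ℝ) t * f t = a * f u := by
  simp only [mul_comm _ (f _), tsum_mul_single]

lemma tsum_gapPoint_mul (hn : 1 ≤ n) (i : Fin n) (k : Fin 3) (f : ℕ+ → ℝ) :
    ∑' t, gapPoint n hn i k t * f t =
      if k = 0 then 1 / (2 * (n : ℝ)) * f 1
      else if k = 1 then 1 / (2 * (n : ℝ)) * f (deadline n hn) else 0 := by
  unfold gapPoint
  split_ifs
  · exact tsum_single_mul _ _ _
  · exact tsum_single_mul _ _ _
  · simp

lemma tsum_gapPoint (hn : 1 ≤ n) (i : Fin n) (k : Fin 3) :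
    ∑' t, gapPoint n hn i k t = if k = 2 then 0 else 1 / (2 * (n : ℝ)) := by
  have h := tsum_gapPoint_mul hn i k fun _ => 1
  simp only [mul_one] at h
  rw [h]
  fin_cases k <;> simp

lemma gapPoint_feasible (hn : 1 ≤ n) : (gapBandit n hn).WhittleFeasible (gapPoint n hn) where
  nonneg i k t := by
    have : (0 : ℝ) ≤ 1 / (2 * (n : ℝ)) := by positivity
    unfold gapPoint
    split_ifs
    · rw [Pi.single_apply]
      split_ifs <;> linarith
    · rw [Pi.single_apply]
      split_ifs <;> linarith
    · exact le_rfl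
  summable i k := by
    refine summable_of_ne_finset_zero (s := {(1 : ℕ+), deadline n hn}) fun t ht => ?_
    have h1 : t ≠ 1 := fun h => ht (by simp [h])
    have h2 : t ≠ deadline n hn := fun h => ht (by simp [h])
    simp only [gapPoint]
    split_ifs <;> simp [h1, h2]
  one_play := by
    have : (1 : ℝ) ≤ n := by exact_mod_cast hn
    simp only [tsum_gapPoint, Fin.sum_univ_three]
    simp
    field_simp
    norm_num
  one_state i := by
    have : (1 : ℝ) ≤ n := by exact_mod_cast hn
    simp only [mul_comm _ (gapPoint n hn _ _ _), tsum_gapPoint_mul, Fin.sum_univ_three]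
    simp
    field_simp
    linarith
  -- The flows 0 → 1 and 1 → 0 are both 1/(2n) · 1/L; times 1 and n are the last ones without flow
  -- into state 2.
  balance i k := by
    fin_cases k
    · simp [univ_erase_zero, gapBandit, tsum_gapPoint_mul]
      simp [gapQ]
    · simp [univ_erase_one, gapBandit, tsum_gapPoint_mul]
      simp [gapQ]
    · simp [univ_erase_two, gapBandit, tsum_gapPoint_mul]
      simp [gapQ]

lemma gapBandit_le_whittleValue (hn : 1 ≤ n) :
    ((1 / 2 : ℝ) : EReal) ≤ (gapBandit n hn).whittleValue := by
  refine le_trans ?_ (le_iSup₂_of_le (gapPoint n hn) (gapPoint_feasible hn) le_rfl)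
  rw [EReal.coe_le_coe_iff, whittleObjective]
  have : (1 : ℝ) ≤ n := by exact_mod_cast hn
  simp only [mul_comm _ (gapPoint n hn _ _ _), tsum_gapPoint_mul, Fin.sum_univ_three]
  simp [gapBandit]
  field_simp
  norm_num

/-! ### The potential of the gap instance -/

/-- The arm is not yet lost: it is in the rewarding state and was just played, or it is in the
waiting state and its deadline has not passed. -/
def Live (n : ℕ) (a : Fin 3 × ℕ+) : Prop := a = (0, 1) ∨ a.1 = 1 ∧ (a.2 : ℕ) ≤ n

open Classical in
/-- The contribution of a single arm to the potential. -/
noncomputable def armValue (n : ℕ) (a : Fin 3 × ℕ+) : ℝ :=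
  if Live n a then stayLength n + 8 else if a.1 = 2 then 0 else 7

/-- The arms in the rewarding state that were just played. -/
def running (s : JointState n 3) : Finset (Fin n) := {i | s i = (0, 1)}

/-- The arms in the waiting state whose deadline has not passed. -/
def waiting (s : JointState n 3) : Finset (Fin n) := {i | (s i).1 = 1 ∧ ((s i).2 : ℕ) ≤ n}

lemma mem_running {s : JointState n 3} {i : Fin n} : i ∈ running s ↔ s i = (0, 1) := by
  simp [running]

lemma mem_waiting {s : JointState n 3} {i : Fin n} :
    i ∈ waiting s ↔ (s i).1 = 1 ∧ ((s i).2 : ℕ) ≤ n := by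
  simp [waiting]

/-- The largest clock of a waiting arm. -/
def maxClock (s : JointState n 3) : ℕ := (waiting s).sup fun i => ((s i).2 : ℕ)

/-- The part of the potential that depends on the interaction of the arms. -/
noncomputable def coupling (s : JointState n 3) : ℝ :=
  if running s = ∅ then
    -- Savings of 1/n per step, reaching 1 with the play at the deadline: the value L of an
    -- undisturbed run times its probability 1/L.
    if (waiting s).card = 1 then ((maxClock s : ℝ) - 1) / n else 0
  -- With another arm waiting, the run can be played only until the oldest waiting clock expires.
  else if waiting s = ∅ then stayLength n else n + 1 - maxClock s

/-- The potential of the gap instance. -/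
noncomputable def gapPotential (s : JointState n 3) : ℝ := ∑ i, armValue n (s i) + coupling s

lemma maxClock_le (s : JointState n 3) : maxClock s ≤ n :=
  Finset.sup_le fun i hi => by simp [waiting] at hi; exact hi.2

lemma one_le_maxClock {s : JointState n 3} (h : (waiting s).Nonempty) : 1 ≤ maxClock s := by
  obtain ⟨i, hi⟩ := h
  exact le_trans (s i).2.pos (Finset.le_sup (f := fun i => ((s i).2 : ℕ)) hi)

lemma coupling_nonneg (s : JointState n 3) : 0 ≤ coupling s := by
  unfold coupling
  have h : (maxClock s : ℝ) ≤ n := by exact_mod_cast maxClock_le s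
  split_ifs with h1 h2 h3
  · have : (1 : ℝ) ≤ maxClock s := by
      exact_mod_cast one_le_maxClock (Finset.card_pos.1 (by omega))
    exact div_nonneg (by linarith) (by positivity)
  · exact le_rfl
  · unfold stayLength; positivity
  · linarith

lemma coupling_le_of_waiting_nonempty (hn : 1 ≤ n) {s : JointState n 3}
    (hw : (waiting s).Nonempty) : coupling s ≤ n := by
  unfold coupling
  have hn' : (1 : ℝ) ≤ n := by exact_mod_cast hn
  have h : (maxClock s : ℝ) ≤ n := by exact_mod_cast maxClock_le s
  have h0 : (1 : ℝ) ≤ maxClock s := by exact_mod_cast one_le_maxClock hw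
  split_ifs with h1 h2 h3
  · rw [div_le_iff₀ (by linarith)]
    nlinarith
  · linarith
  · exact absurd h3 hw.ne_empty
  · linarith

lemma coupling_le (hn : 1 ≤ n) (s : JointState n 3) : coupling s ≤ stayLength n := by
  have h2 := two_mul_le_stayLength hn
  have hn' : (1 : ℝ) ≤ n := by exact_mod_cast hn
  rcases (waiting s).eq_empty_or_nonempty with h | h
  · unfold coupling
    simp only [h, Finset.card_empty, zero_ne_one, if_false, if_true]
    split_ifs <;> linarith
  · linarith [coupling_le_of_waiting_nonempty hn h]

lemma armValue_nonneg (a : Fin 3 × ℕ+) : 0 ≤ armValue n a := by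
  unfold armValue stayLength
  split_ifs <;> positivity

lemma gapPotential_nonneg (s : JointState n 3) : 0 ≤ gapPotential s :=
  add_nonneg (Finset.sum_nonneg fun _ _ => armValue_nonneg _) (coupling_nonneg s)

lemma ne_running_of_succ (k : Fin 3) (t : ℕ+) : (k, t + 1) ≠ ((0, 1) : Fin 3 × ℕ+) := fun h =>
  (PNat.lt_add_left 1 t).ne' (congrArg Prod.snd h)

lemma Live.of_succ {k : Fin 3} {t : ℕ+} (h : Live n (k, t + 1)) : Live n (k, t) := by
  rcases h with h | ⟨h1, h2⟩
  · exact absurd h (ne_running_of_succ _ _)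
  · refine Or.inr ⟨h1, ?_⟩
    simp at h2 ⊢
    omega

lemma armValue_succ_le (a : Fin 3 × ℕ+) : armValue n (a.1, a.2 + 1) ≤ armValue n a := by
  have h0 : (0 : ℝ) ≤ stayLength n := by unfold stayLength; positivity
  have := Live.of_succ (n := n) (k := a.1) (t := a.2)
  unfold armValue
  simp only [Prod.mk.eta] at this
  split_ifs <;> first | linarith | tauto

/-- The drop L + 1 covers the largest possible coupling, L, plus one reward, so a step that loses an
unplayed arm needs no finer analysis. -/
lemma armValue_succ_le_of_lost {a : Fin 3 × ℕ+} (h : Live n a) (h' : ¬ Live n (a.1, a.2 + 1)) :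
    armValue n (a.1, a.2 + 1) ≤ armValue n a - (stayLength n + 1) := by
  unfold armValue
  rw [if_pos h, if_neg h']
  split_ifs <;> linarith

lemma sum_armValue_succ_le (S : Finset (Fin n)) (s : JointState n 3) :
    ∑ i ∈ S, armValue n (afterIdle s i) ≤ ∑ i ∈ S, armValue n (s i) :=
  Finset.sum_le_sum fun i _ => armValue_succ_le (s i)

lemma sum_armValue_succ_le_of_lost {S : Finset (Fin n)} {s : JointState n 3} {i : Fin n}
    (hi : i ∈ S) (h : Live n (s i)) (h' : ¬ Live n (afterIdle s i)) :
    ∑ i ∈ S, armValue n (afterIdle s i) ≤ ∑ i ∈ S, armValue n (s i) - (stayLength n + 1) := by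
  rw [← Finset.add_sum_erase _ _ hi, ← Finset.add_sum_erase S (fun i => armValue n (s i)) hi]
  have h1 : armValue n (afterIdle s i) ≤ armValue n (s i) - (stayLength n + 1) :=
    armValue_succ_le_of_lost h h'
  linarith [sum_armValue_succ_le (S.erase i) s]

lemma sum_armValue_afterPlay (s : JointState n 3) (i : Fin n) (j : Fin 3) :
    ∑ l, armValue n (afterPlay s i j l) =
      armValue n (j, 1) + ∑ l ∈ Finset.univ.erase i, armValue n (afterIdle s l) := by
  rw [← Finset.add_sum_erase _ _ (Finset.mem_univ i)]
  congr 1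
  · simp [afterPlay]
  · exact Finset.sum_congr rfl fun l hl => by simp [afterPlay, Finset.ne_of_mem_erase hl]

/-! ### Change of the coupling when no unplayed arm is lost -/

/-- The arms in `S` do not get lost in the next step if they are not played. -/
def Safe (S : Finset (Fin n)) (s : JointState n 3) : Prop :=
  ∀ i ∈ S, Live n (s i) → Live n (afterIdle s i)

lemma Safe.ne_running {S : Finset (Fin n)} {s : JointState n 3} (h : Safe S s) {i : Fin n}
    (hi : i ∈ S) : s i ≠ (0, 1) := by
  intro hc
  rcases h i hi (Or.inl hc) with h' | h'
  · exact ne_running_of_succ _ _ h'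
  · simp [afterIdle, hc] at h'

lemma Safe.waiting_iff {S : Finset (Fin n)} {s : JointState n 3} (h : Safe S s) {i : Fin n}
    (hi : i ∈ S) : i ∈ waiting (afterIdle s) ↔ i ∈ waiting s := by
  constructor
  · intro hw
    simp [waiting, afterIdle] at hw ⊢
    exact ⟨hw.1, by omega⟩
  · intro hw
    simp [waiting] at hw
    rcases h i hi (Or.inr hw) with h' | h'
    · exact absurd h' (ne_running_of_succ _ _)
    · exact mem_waiting.2 h'

lemma running_afterIdle (s : JointState n 3) : running (afterIdle s) = ∅ := by
  exact Finset.eq_empty_of_forall_notMem fun i hi =>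
    ne_running_of_succ _ _ (mem_running.1 hi)

lemma mem_waiting_afterPlay {s : JointState n 3} {i l : Fin n} {j : Fin 3} (hl : l ≠ i) :
    l ∈ waiting (afterPlay s i j) ↔ l ∈ waiting (afterIdle s) := by
  simp [mem_waiting, afterPlay, hl]

lemma mem_waiting_afterPlay_self (hn : 1 ≤ n) {s : JointState n 3} {i : Fin n} {j : Fin 3} :
    i ∈ waiting (afterPlay s i j) ↔ j = 1 := by
  simp [mem_waiting, afterPlay, hn]

lemma running_afterPlay (s : JointState n 3) (i : Fin n) (j : Fin 3) :
    running (afterPlay s i j) = if j = 0 then {i} else ∅ := by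
  ext l
  by_cases hl : l = i
  · subst hl
    by_cases hj : j = 0 <;> simp [mem_running, afterPlay, hj]
  · have h1 : afterIdle s l ≠ (0, 1) := ne_running_of_succ _ _
    split_ifs <;> simp [mem_running, afterPlay, hl, h1]

lemma waiting_afterPlay_of_ne (hn : 1 ≤ n) {s : JointState n 3} {i : Fin n} {j : Fin 3}
    (h : Safe (Finset.univ.erase i) s) (hj : j ≠ 1) :
    waiting (afterPlay s i j) = (waiting s).erase i := by
  ext l
  by_cases hl : l = i
  · subst hl
    simp [mem_waiting_afterPlay_self hn, hj]
  · rw [mem_waiting_afterPlay hl, h.waiting_iff (by simp [hl])]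
    simp [hl]

/-- Without a running arm, only the savings of a sole waiting arm grow, by one clock tick. -/
lemma coupling_le_of_waiting_eq (hn : 1 ≤ n) {s s' : JointState n 3} (hr : running s = ∅)
    (hr' : running s' = ∅) (hw : waiting s' = waiting s)
    (hc : ∀ i ∈ waiting s, ((s' i).2 : ℕ) = (s i).2 + 1) :
    coupling s' ≤ coupling s + 1 / n := by
  have hn' : (0 : ℝ) < n := by exact_mod_cast hn
  have h1 : maxClock s' ≤ maxClock s + 1 := by
    unfold maxClock
    rw [hw]
    refine Finset.sup_le fun i hi => ?_
    rw [hc i hi]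
    exact Nat.succ_le_succ (Finset.le_sup (f := fun i => ((s i).2 : ℕ)) hi)
  have h1' : (maxClock s' : ℝ) ≤ maxClock s + 1 := by exact_mod_cast h1
  unfold coupling
  rw [if_pos hr, if_pos hr', hw]
  split_ifs
  · rw [← add_div, div_le_div_iff_of_pos_right hn']
    linarith
  · positivity

lemma gapPotential_afterIdle_le (hn : 1 ≤ n) (s : JointState n 3) :
    gapPotential (afterIdle s) ≤ gapPotential s + 1 / n := by
  have hn' : (0 : ℝ) ≤ 1 / (n : ℝ) := by positivity
  unfold gapPotential
  by_cases h : Safe Finset.univ s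
  · have hr : running s = ∅ := Finset.eq_empty_of_forall_notMem fun i hi =>
      h.ne_running (Finset.mem_univ i) (by simpa [running] using hi)
    have := coupling_le_of_waiting_eq hn hr (running_afterIdle s)
      (Finset.ext fun i => h.waiting_iff (Finset.mem_univ i)) fun i _ => by simp [afterIdle]
    linarith [sum_armValue_succ_le Finset.univ s]
  · simp only [Safe, not_forall] at h
    obtain ⟨i, hi, h1, h2⟩ := h
    linarith [sum_armValue_succ_le_of_lost hi h1 h2, coupling_le hn (afterIdle s),
      coupling_nonneg s]

/-- No arm is running afterwards, and if arm `i` is the only one waiting, its clock 1 means no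
savings. -/
lemma coupling_afterPlay_one (hn : 1 ≤ n) (s : JointState n 3) (i : Fin n) :
    coupling (afterPlay s i 1) = 0 := by
  unfold coupling
  rw [running_afterPlay, if_neg one_ne_zero, if_pos rfl]
  split_ifs with hc
  · obtain ⟨l, hl⟩ := Finset.card_eq_one.1 hc
    have hi : i ∈ waiting (afterPlay s i 1) := (mem_waiting_afterPlay_self hn).2 rfl
    rw [hl, Finset.mem_singleton] at hi
    subst hi
    rw [maxClock, hl]
    simp [afterPlay]
  · rfl

lemma coupling_afterPlay_two_le (hn : 1 ≤ n) {s : JointState n 3} {i : Fin n}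
    (h : Safe (Finset.univ.erase i) s) (hi : ¬ Live n (s i)) :
    coupling (afterPlay s i 2) ≤ coupling s + 1 / n := by
  have hiw : i ∉ waiting s := fun hc => hi (Or.inr (by simpa [waiting] using hc))
  refine coupling_le_of_waiting_eq hn ?_ ?_ ?_ ?_
  · refine Finset.eq_empty_of_forall_notMem fun l hl => ?_
    have hl' : s l = (0, 1) := by simpa [running] using hl
    by_cases hli : l = i
    · subst hli
      exact hi (Or.inl hl')
    · exact h.ne_running (by simp [hli]) hl'
  · rw [running_afterPlay, if_neg (by decide)]
  · rw [waiting_afterPlay_of_ne hn h (by decide), Finset.erase_eq_of_notMem hiw]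
  · intro l hl
    have : l ≠ i := fun hc => hiw (hc ▸ hl)
    simp [afterPlay, afterIdle, this]

lemma coupling_of_running {s : JointState n 3} {i : Fin n} (h : s i = (0, 1)) :
    coupling s = if waiting s = ∅ then stayLength n else n + 1 - maxClock s := by
  have : running s ≠ ∅ := Finset.ne_empty_of_mem (a := i) (by simp [running, h])
  simp [coupling, this]

/-- Continuing with the running arm uses up the coupling, unless it is the only live arm. -/
lemma coupling_afterPlay_zero_of_running (hn : 1 ≤ n) {s : JointState n 3} {i : Fin n}
    (h : Safe (Finset.univ.erase i) s) (hi : s i = (0, 1)) :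
    coupling s = stayLength n ∨ 1 ≤ coupling s ∧ coupling (afterPlay s i 0) ≤ coupling s - 1 := by
  have hiw : i ∉ waiting s := by simp [waiting, hi]
  have hw := waiting_afterPlay_of_ne hn h (j := 0) (by decide)
  rw [Finset.erase_eq_of_notMem hiw] at hw
  rw [coupling_of_running hi, coupling_of_running (i := i) (by simp [afterPlay]), hw]
  split_ifs with he
  · exact Or.inl rfl
  · right
    -- The oldest waiting arm ages by one and, by safety, still waits.
    obtain ⟨l, hl, hls⟩ := Finset.exists_mem_eq_sup _ (Finset.nonempty_iff_ne_empty.2 he)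
      (fun i => ((s i).2 : ℕ))
    have hli : l ≠ i := fun hc => hiw (hc ▸ hl)
    have h1 : maxClock s + 1 ≤ maxClock (afterPlay s i 0) := by
      have h2 : ((afterPlay s i 0 l).2 : ℕ) ≤ maxClock (afterPlay s i 0) :=
        Finset.le_sup (f := fun l => ((afterPlay s i 0 l).2 : ℕ)) (hw ▸ hl)
      have h3 : maxClock s = (s l).2 := hls
      have h4 : ((afterPlay s i 0 l).2 : ℕ) = (s l).2 + 1 := by simp [afterPlay, hli, afterIdle]
      omega
    have h1' : (maxClock s : ℝ) + 1 ≤ maxClock (afterPlay s i 0) := by exact_mod_cast h1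
    have h5 : (maxClock s : ℝ) ≤ n := by exact_mod_cast maxClock_le s
    constructor <;> linarith

/-- Playing a waiting arm at its deadline. -/
lemma coupling_afterPlay_zero_of_deadline (hn : 1 ≤ n) {s : JointState n 3} {i : Fin n}
    (h : Safe (Finset.univ.erase i) s) (hi : (s i).1 = 1) (ht : ((s i).2 : ℕ) = n) :
    (stayLength n)⁻¹ * coupling (afterPlay s i 0) ≤ coupling s + 1 / n := by
  have hn' : (0 : ℝ) < n := by exact_mod_cast hn
  have hp := inv_stayLength_pos hn
  have hiw : i ∈ waiting s := by simp [waiting, hi, ht]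
  have hw := waiting_afterPlay_of_ne hn h (j := 0) (by decide)
  rcases ((waiting s).erase i).eq_empty_or_nonempty with he | he
  · have hws : waiting s = {i} := by
      rw [← Finset.insert_erase hiw, he, insert_empty_eq]
    have hr : running s = ∅ := by
      refine Finset.eq_empty_of_forall_notMem fun l hl => ?_
      have hl' : s l = (0, 1) := by simpa [running] using hl
      by_cases hli : l = i
      · subst hli
        simp [hl'] at hi
      · exact h.ne_running (by simp [hli]) hl'
    -- A sole live arm: savings (n - 1)/n plus the allowance 1/n equal L⁻¹ · L exactly.
    have hc : coupling s = ((n : ℝ) - 1) / n := by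
      simp [coupling, hr, hws, maxClock, ht]
    have h1 := mul_le_mul_of_nonneg_left (coupling_le hn (afterPlay s i 0)) hp.le
    rw [inv_stayLength_mul hn] at h1
    rw [hc, ← add_div, sub_add_cancel, div_self hn'.ne']
    exact h1
  · have h1 := mul_le_mul_of_nonneg_left
      (coupling_le_of_waiting_nonempty hn (s := afterPlay s i 0) (hw ▸ he)) hp.le
    -- Another arm waits, so the run is worth at most n; the quadratic size of L enters here.
    have h2 : (stayLength n)⁻¹ * n ≤ 1 / n := by
      rw [stayLength, inv_mul_le_iff₀ (by positivity)]
      field_simp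
      norm_num
    linarith [coupling_nonneg s]

lemma armValue_one (hn : 1 ≤ n) : armValue n (1, 1) = stayLength n + 8 :=
  if_pos (Or.inr ⟨rfl, by simpa using hn⟩)

lemma armValue_zero : armValue n (0, 1) = stayLength n + 8 := if_pos (Or.inl rfl)

lemma armValue_two (t : ℕ+) : armValue n (2, t) = 0 := by simp [armValue, Live]

/-! ### One-step drift of the potential -/

lemma gapBandit_stepProb_zero (hn : 1 ≤ n) (i : Fin n) (t : ℕ+) (f : Fin 3 → ℝ) :
    ∑ j, (gapBandit n hn).stepProb i 0 t j * f j =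
      (stayLength n)⁻¹ * f 1 + (1 - (stayLength n)⁻¹) * if t = 1 then f 0 else f 2 := by
  simp [Fin.sum_univ_three, stepProb, univ_erase_zero, gapBandit, gapQ]
  split_ifs <;> ring

lemma gapBandit_stepProb_one (hn : 1 ≤ n) (i : Fin n) (t : ℕ+) (f : Fin 3 → ℝ) :
    ∑ j, (gapBandit n hn).stepProb i 1 t j * f j =
      if (t : ℕ) < n then f 1 else
        (stayLength n)⁻¹ * f 0 + (1 - (stayLength n)⁻¹) * if (t : ℕ) ≤ n then f 1 else f 2 := by
  simp [Fin.sum_univ_three, stepProb, univ_erase_one, gapBandit, gapQ]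
  split_ifs <;> first | omega | ring

lemma gapBandit_stepProb_two (hn : 1 ≤ n) (i : Fin n) (t : ℕ+) (f : Fin 3 → ℝ) :
    ∑ j, (gapBandit n hn).stepProb i 2 t j * f j = f 2 := by
  simp [stepProb, gapBandit, gapQ]

/-- The change of the potential when an arm is played, as a bound on the part that involves the
played arm and the coupling. -/
lemma gapPotential_afterPlay_le_of_bound (hn : 1 ≤ n) {s : JointState n 3} {i : Fin n} {b : ℝ}
    (hb : ∑ l ∈ Finset.univ.erase i, armValue n (afterIdle s l) + b ≤
      ∑ l ∈ Finset.univ.erase i, armValue n (s l) + armValue n (s i) + coupling s + 1 / n)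
    (h : (gapBandit n hn).reward i (s i).1 +
      ∑ j, (gapBandit n hn).stepProb i (s i).1 (s i).2 j *
        (armValue n (j, 1) + coupling (afterPlay s i j)) ≤ b) :
    (gapBandit n hn).reward i (s i).1 +
      ∑ j, (gapBandit n hn).stepProb i (s i).1 (s i).2 j * gapPotential (afterPlay s i j) ≤
        gapPotential s + 1 / n := by
  have h1 : ∀ j, gapPotential (afterPlay s i j) =
      (armValue n (j, 1) + coupling (afterPlay s i j)) +
        ∑ l ∈ Finset.univ.erase i, armValue n (afterIdle s l) := fun j => by
    rw [gapPotential, sum_armValue_afterPlay]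
    ring
  simp only [h1, mul_add _ _ (∑ l ∈ Finset.univ.erase i, armValue n (afterIdle s l)),
    Finset.sum_add_distrib]
  rw [← Finset.sum_mul, sum_stepProb, gapPotential,
    ← Finset.add_sum_erase _ (fun l => armValue n (s l)) (Finset.mem_univ i)]
  linarith

/-- The part of the drift that involves the played arm, if the coupling gets as large as it can. -/
lemma gapBandit_drift_le (hn : 1 ≤ n) (i : Fin n) (a : Fin 3 × ℕ+) (c : Fin 3 → ℝ)
    (hc : ∀ j, c j ≤ stayLength n) :
    (gapBandit n hn).reward i a.1 +
      ∑ j, (gapBandit n hn).stepProb i a.1 a.2 j * (armValue n (j, 1) + c j) ≤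
        armValue n a + stayLength n + 1 := by
  have hp := inv_stayLength_pos hn
  have hp' := inv_stayLength_le hn
  have hm := inv_stayLength_mul hn
  have hL := two_le_stayLength hn
  obtain ⟨k, t⟩ := a
  have h0 : (stayLength n)⁻¹ * c 0 ≤ (stayLength n)⁻¹ * stayLength n :=
    mul_le_mul_of_nonneg_left (hc 0) hp.le
  have h1 : (stayLength n)⁻¹ * c 1 ≤ (stayLength n)⁻¹ * stayLength n :=
    mul_le_mul_of_nonneg_left (hc 1) hp.le
  have h0' := mul_le_mul_of_nonneg_left (hc 0) (by linarith : 0 ≤ 1 - (stayLength n)⁻¹)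
  have h1' := mul_le_mul_of_nonneg_left (hc 1) (by linarith : 0 ≤ 1 - (stayLength n)⁻¹)
  have h2' := mul_le_mul_of_nonneg_left (hc 2) (by linarith : 0 ≤ 1 - (stayLength n)⁻¹)
  have hv0 := armValue_zero (n := n)
  have hv1 := armValue_one hn
  have hv2 := armValue_two (n := n) 1
  fin_cases k
  · simp only [Fin.zero_eta, gapBandit_stepProb_zero, hv0, hv1, hv2]
    by_cases ht : t = 1
    · subst ht
      simp [gapBandit, hv0]
      linarith
    · simp [gapBandit, armValue, Live, ht]
      linarith
  · simp only [Fin.mk_one, gapBandit_stepProb_one, hv0, hv1, hv2]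
    rcases lt_trichotomy (t : ℕ) n with ht | ht | ht
    · simp [gapBandit, armValue, Live, ht, ht.le]
      linarith [hc 1]
    · simp [gapBandit, armValue, Live, ht]
      linarith
    · simp [gapBandit, armValue, Live, ht.not_gt, ht.not_ge]
      linarith
  · simp only [Fin.reduceFinMk, gapBandit_stepProb_two, hv2, armValue_two]
    simp [gapBandit]
    linarith [hc 2]

/-- The part of the drift that involves the played arm, in terms of bounds on the coupling before
the step (`C`) and after the step (`c`). -/
lemma gapBandit_drift_le_of_coupling (hn : 1 ≤ n) (i : Fin n) (a : Fin 3 × ℕ+) (c : Fin 3 → ℝ)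
    {C ε : ℝ} (hε : 0 ≤ ε) (hC : 0 ≤ C) (h0 : c 0 ≤ stayLength n) (h1 : c 1 = 0)
    (h2 : ¬ Live n a → c 2 ≤ C + ε)
    (hr : a = (0, 1) → C = stayLength n ∨ 1 ≤ C ∧ c 0 ≤ C - 1)
    (hd : a.1 = 1 → (a.2 : ℕ) = n → (stayLength n)⁻¹ * c 0 ≤ C + ε) :
    (gapBandit n hn).reward i a.1 +
      ∑ j, (gapBandit n hn).stepProb i a.1 a.2 j * (armValue n (j, 1) + c j) ≤
        armValue n a + C + ε := by
  have hp := inv_stayLength_pos hn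
  have hp' := inv_stayLength_le hn
  have hm := inv_stayLength_mul hn
  have h0' := mul_le_mul_of_nonneg_left h0 hp.le
  have h2' : ¬ Live n a → (1 - (stayLength n)⁻¹) * c 2 ≤ C + ε := fun hl =>
    le_trans (mul_le_mul_of_nonneg_left (h2 hl) (by linarith))
      (mul_le_of_le_one_left (by linarith) (by linarith))
  have hv0 := armValue_zero (n := n)
  have hv1 := armValue_one hn
  have hv2 := armValue_two (n := n) 1
  obtain ⟨k, t⟩ := a
  fin_cases k
  · simp only [Fin.zero_eta, gapBandit_stepProb_zero, hv0, hv1, hv2, h1]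
    by_cases ht : t = 1
    · subst ht
      simp only [gapBandit, hv0, if_true]
      -- An undisturbed run balances exactly, 1 + (1 - 1/L) L = L; otherwise the reward 1 is paid by
      -- the drop of the coupling.
      rcases hr rfl with hr | ⟨hr, hr'⟩
      · rw [hr]
        nlinarith
      · nlinarith
    · have hl : ¬ Live n ((0 : Fin 3), t) := by simp [Live, ht]
      have := h2' hl
      -- The value 7 of a lost arm covers its reward 1 and its chance of revival, (L + 8)/L ≤ 5.
      simp [gapBandit, armValue, hl, ht]
      linarith
  · simp only [Fin.mk_one, gapBandit_stepProb_one, hv0, hv1, hv2, h1]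
    rcases lt_trichotomy (t : ℕ) n with ht | ht | ht
    · simp [gapBandit, armValue, Live, ht, ht.le] 
      linarith
    · have := hd rfl ht
      simp [gapBandit, armValue, Live, ht]
      linarith
    · have hl : ¬ Live n ((1 : Fin 3), t) := by simp [Live, ht]
      have := h2' hl
      simp [gapBandit, armValue, hl, ht.not_gt, ht.not_ge]
      linarith
  · have := h2 (by simp [Live])
    simp only [Fin.reduceFinMk, gapBandit_stepProb_two, hv2, armValue_two]
    simp [gapBandit]
    linarith

lemma gapBandit_drift_le_of_safe (hn : 1 ≤ n) {s : JointState n 3} {i : Fin n}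
    (h : Safe (Finset.univ.erase i) s) :
    (gapBandit n hn).reward i (s i).1 +
      ∑ j, (gapBandit n hn).stepProb i (s i).1 (s i).2 j *
        (armValue n (j, 1) + coupling (afterPlay s i j)) ≤
          armValue n (s i) + coupling s + 1 / n :=
  gapBandit_drift_le_of_coupling hn i (s i) (fun j => coupling (afterPlay s i j)) (by positivity)
    (coupling_nonneg s) (coupling_le hn _) (coupling_afterPlay_one hn s i)
    (coupling_afterPlay_two_le hn h) (coupling_afterPlay_zero_of_running hn h)
    (coupling_afterPlay_zero_of_deadline hn h)

lemma gapPotential_afterPlay_le (hn : 1 ≤ n) (s : JointState n 3) (i : Fin n) :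
    (gapBandit n hn).reward i (s i).1 +
      ∑ j, (gapBandit n hn).stepProb i (s i).1 (s i).2 j * gapPotential (afterPlay s i j) ≤
        gapPotential s + 1 / n := by
  have hn' : (0 : ℝ) ≤ 1 / (n : ℝ) := by positivity
  by_cases h : Safe (Finset.univ.erase i) s
  · refine gapPotential_afterPlay_le_of_bound hn ?_ (gapBandit_drift_le_of_safe hn h)
    linarith [sum_armValue_succ_le (Finset.univ.erase i) s]
  -- Some unplayed arm is lost, and its drop L + 1 pays for the crude bound.
  · refine gapPotential_afterPlay_le_of_bound hn ?_
      (gapBandit_drift_le hn i (s i) _ fun j => coupling_le hn _)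
    simp only [Safe, not_forall] at h
    obtain ⟨l, hl, h1, h2⟩ := h
    linarith [sum_armValue_succ_le_of_lost hl h1 h2, coupling_nonneg s]

theorem gapBandit_averageReward_le (hn : 1 ≤ n) (π : Policy n 3) (s : JointState n 3) :
    (gapBandit n hn).averageReward π s ≤ ((1 / (n : ℝ) : ℝ) : EReal) :=
  averageReward_le_of_expReward_le _ π s (gapPotential s) _ fun T =>
    expReward_le_of_potential _ gapPotential _ gapPotential_nonneg (gapPotential_afterIdle_le hn)
      (gapPotential_afterPlay_le hn) π T [] s

end GapInstance

end MonotoneTransitionBandit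

theorem mainTheorem11 :
    ∃ c C : ℝ, 0 < c ∧ 0 < C ∧
      ∀ n : ℕ, 1 ≤ n →
        ∃ B : MonotoneTransitionBandit n 3,
          ¬ B.Separable ∧
          (∀ i, ∃ a, B.IsAbsorbing i a ∧ B.reward i a = 0) ∧
          (c : EReal) ≤ B.whittleValue ∧ B.whittleValue ≤ (C : EReal) ∧
          (∀ (π : MonotoneTransitionBandit.Policy n 3)
              (s : MonotoneTransitionBandit.JointState n 3),
            B.averageReward π s ≤ ((1 / (n : ℝ) : ℝ) : EReal)) ∧
          ((c * (n : ℝ) : ℝ) : EReal) * B.optimalReward ≤ B.whittleValue := by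
  refine ⟨1 / 2, 1, by norm_num, by norm_num, fun n hn => ?_⟩
  refine ⟨.gapBandit n hn, MonotoneTransitionBandit.gapBandit_not_separable hn, fun i =>
    ⟨2, MonotoneTransitionBandit.gapBandit_isAbsorbing hn i,
      by simp [MonotoneTransitionBandit.gapBandit]⟩,
    MonotoneTransitionBandit.gapBandit_le_whittleValue hn,
    MonotoneTransitionBandit.whittleValue_le_one_of_reward_le_one _ fun i k => ?_,
    MonotoneTransitionBandit.gapBandit_averageReward_le hn, ?_⟩
  · simp only [MonotoneTransitionBandit.gapBandit]
    split_ifs <;> norm_num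
  -- OPT ≤ 1/n gives (n/2) · OPT ≤ 1/2, which is the lower bound on the LP.
  · refine le_trans ?_ (MonotoneTransitionBandit.gapBandit_le_whittleValue hn)
    have hn' : (0 : ℝ) < n := by exact_mod_cast hn
    have h : (MonotoneTransitionBandit.gapBandit n hn).optimalReward ≤
        ((1 / (n : ℝ) : ℝ) : EReal) :=
      iSup₂_le (MonotoneTransitionBandit.gapBandit_averageReward_le hn)
    refine le_trans (mul_le_mul_of_nonneg_left h (EReal.coe_nonneg.2 (by positivity))) ?_
    rw [← EReal.coe_mul, EReal.coe_le_coe_iff]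
    field_simp
    exact le_rfl
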